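/- Throughout, $\log=\log_2$. For a string $s$ of length $n$ over an alphabet of size $\sigma$ let $H_0(s)=\sum_a \frac{\mathrm{occ}(a,s)}{n}\log\frac{n}{\mathrm{occ}(a,s)}$, where $\mathrm{occ}(a,s)$ is the number of occurrences of the character $a$ in $s$ (characters that do not occur contribute $0$), and let $H_k(s)=\frac1n\sum_{|w|=k}|w_s|\,H_0(w_s)$, where $w_s$ is the concatenation of the characters immediately following the occurrences of the $k$-tuple $w$ in $s$. A one-encoding-pass algorithm with $b$ bits of memory over an alphabet of size $\sigma$ is a deterministic algorithm that makes any number (possibly zero) of preliminary left-to-right passes over its input $s$ without producing output, followed by one left-to-right encoding pass that produces all of its output, a bit string. In each pass it reads the characters one by one, and all that it carries along is its memory, which has $2^b$ possible contents: the new contents, the bits output on reading a character or at the end of the encoding pass, and the decision at the end of a preliminary pass whether to begin another one or the encoding pass, depend only on the kind of pass, the current contents and (where one is read) the character. There is no restriction on time. The algorithm stores strings losslessly if it halts on every input and any two different strings of equal length have different outputs. Theorem. Let $\lambda\ge 1$, $k\in\{0,1,2,\dots\}$ and $\epsilon>0$ be constants, let $g=g(\sigma)$ be a real function independent of $n$,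 and let $f(n,\sigma)=o(n\log\sigma)$, in the sense that for every $\delta>0$ and all sufficiently large $\sigma$ we have $|f(n,\sigma)|\le\delta\, n\log\sigma$ for all sufficiently large $n$ (how large may depend on $\sigma$). Let $b(\sigma)=O(\sigma^{k+1/\lambda-\epsilon})$ as $\sigma\to\infty$ and, for every $\sigma$, let $A_\sigma$ be a one-encoding-pass algorithm with $b(\sigma)$ bits of memory over an alphabet of size $\sigma$ that stores strings losslessly. Then for every sufficiently large $\sigma$ there are infinitely many $n$ for which there is a string $s$ of length $n$ over the alphabet such that $A_\sigma$ stores $s$ in more than $$\lambda H_k(s)\,n+f(n,\sigma)+g(\sigma)$$ bits. In particular, no such algorithm stores every string $s$ in $\lambda H_k(s)n+o(n\log\sigma)+g$ bits. -/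

import Mathlib

open Filter Asymptotics

namespace OnePass

noncomputable section

/-! ### Empirical entropy -/

/-- The `0`th-order empirical entropy
`H₀(s) = ∑ₐ (occ(a,s) / n) log₂ (n / occ(a,s))` of a string `s` of length `n`
over the alphabet `Fin σ` (a character that does not occur contributes `0`). -/
def entropy0 {σ : ℕ} (s : List (Fin σ)) : ℝ :=
  ∑ a : Fin σ, ((s.count a : ℝ) / (s.length : ℝ)) *
    Real.logb 2 ((s.length : ℝ) / (s.count a : ℝ))

/-- The string `w_s` of the characters that immediately follow the
(possibly overlapping) occurrences of `w` in `s`, from left to right. -/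
def followers {σ : ℕ} (w s : List (Fin σ)) : List (Fin σ) :=
  s.tails.filterMap fun t => if w <+: t then t[w.length]? else none

/-- The `k`th-order empirical entropy `H_k(s) = (1/n) ∑_{|w| = k} |w_s| H₀(w_s)`.
For `k = 0` the only context is the empty one, whose followers are all of `s`. -/
def entropy {σ : ℕ} (k : ℕ) (s : List (Fin σ)) : ℝ :=
  (∑ w : Fin k → Fin σ, ((followers (List.ofFn w) s).length : ℝ) *
    entropy0 (followers (List.ofFn w) s)) / (s.length : ℝ)

/-! ### Compression with one encoding pass -/

/-- The possible contents of a memory of `b` bits. -/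
abbrev Memory (b : ℕ) : Type := Fin b → Bool

/-- What happens next, when the reading head stands at the beginning of the input:
a preliminary pass or the encoding pass, with the given memory contents. -/
inductive Phase (b : ℕ) : Type
  | preliminary (m : Memory b) : Phase b
  | encoding (m : Memory b) : Phase b

/-- A deterministic algorithm over the alphabet `Fin σ` with `b` bits of memory that makes any
number of preliminary passes over the input, all of them without output, followed by a single
encoding pass that produces all of the output. In each pass the characters are read one by one
from left to right, and nothing but the memory is carried along. There is no bound on the time
or on the complexity of the maps. -/
structure Algorithm (σ b : ℕ) where
  /-- the first pass and the initial contents of the memory -/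
  init : Phase b
  /-- how reading a character changes the memory in a preliminary pass -/
  scan : Memory b → Fin σ → Memory b
  /-- what to do next after a preliminary pass -/
  endScan : Memory b → Phase b
  /-- how reading a character changes the memory in the encoding pass -/
  update : Memory b → Fin σ → Memory b
  /-- the bits that are output when a character is read in the encoding pass -/
  emit : Memory b → Fin σ → List Bool
  /-- the bits that are output at the end of the encoding pass -/
  finish : Memory b → List Bool

namespace Algorithm

variable {σ b : ℕ} (A : Algorithm σ b)

/-- The output of the encoding pass over a string, begun with given memory contents. -/
def encodeFrom : Memory b → List (Fin σ) → List Bool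
  | m, [] => A.finish m
  | m, a :: s => A.emit m a ++ encodeFrom (A.update m a) s

/-- `A.Run s p w`: on the input `s`, the algorithm, with the reading head at the beginning of `s`
and continuing with the phase `p`, eventually halts with the output `w`. -/
inductive Run (s : List (Fin σ)) : Phase b → List Bool → Prop
  | encode (m : Memory b) : Run s (Phase.encoding m) (A.encodeFrom m s)
  | scan (m : Memory b) (w : List Bool) :
      Run s (A.endScan (s.foldl A.scan m)) w → Run s (Phase.preliminary m) w

/-- The algorithm, on the input `s`, halts and stores the bit string `w`. -/
def Stores (s : List (Fin σ)) (w : List Bool) : Prop := A.Run s A.init w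

/-- The algorithm halts on every input, and every string is determined by its length together
with the stored bits. -/
def Lossless : Prop :=
  (∀ s, ∃ w, A.Stores s w) ∧
    ∀ s t w, s.length = t.length → A.Stores s w → A.Stores t w → s = t

end Algorithm

/-- `f n σ = o(n log σ)`, in the weakest sense: the limit superior over `n` of the ratio
`|f n σ| / (n log₂ σ)` for fixed `σ` tends to `0` as `σ` grows. -/
def IsLittleOLengthLog (f : ℕ → ℕ → ℝ) : Prop :=
  ∀ δ : ℝ, 0 < δ → ∀ᶠ σ : ℕ in atTop, ∀ᶠ n : ℕ in atTop,
    |f n σ| ≤ δ * ((n : ℝ) * Real.logb 2 (σ : ℝ))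

end

end OnePass

/-! The hard inputs are almost periodic. Fix `α` slightly below `1 / lam` and consider blocks of
length `ℓ`, of order `σ ^ (k + α)`, in which no `k`-tuple occurs more than `T ≈ σ ^ α` times.
Repeating such a block costs at most about `α * log σ` bits of `k`th-order entropy per character
(`entropy_mul_length_le`), yet there are at least `(σ / 2) ^ ℓ` such blocks (`exists_many_sparse`,
`two_pow_le_sub_pow`). Since `2 * b < ℓ`, the pigeonhole principle yields a block `u` that in every
state either costs nearly `ℓ * log σ` bits or can be exchanged for another block with the same
output and the same next state (`exists_block`).

An exchange alone does not contradict losslessness: the preliminary passes may start the encoding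
pass with other memory contents on the changed input. But these contents are only `b` bits, so
counting helps (`exists_long_output`). Among sequences of `K` blocks, exactly `j` of them different
from `u`, a cheap occurrence of `u` leads by exchange to a sequence with `j + 1` deviations; that
sequence and the original start determine the original sequence and the position. The layer `j + 1`
is at most `K * |U| / (j + 1)` times as large as the layer `j`, where `U` is the set of blocks. So
for a large constant `j` some sequence has few cheap positions and an output of nearly `K * ℓ * log
σ` bits, while its `j` deviations hardly affect the entropy as `K` grows. -/

namespace OnePass

/-! ### Occurrences of a string in a string -/

section Occurrences

variable {α : Type*} [DecidableEq α]

/-- The number of (possibly overlapping) occurrences of `w` in `s`. -/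
def occ (w s : List α) : ℕ := s.tails.countP fun t => w <+: t

theorem occ_nil (w : List α) : occ w [] = if w = [] then 1 else 0 := by
  simp [occ, List.countP_cons]

theorem occ_cons (w : List α) (a : α) (s : List α) :
    occ w (a :: s) = occ w s + if w <+: a :: s then 1 else 0 := by
  simp [occ, List.countP_cons]

theorem occ_nil_left (s : List α) : occ [] s = s.length + 1 := by
  induction s with
  | nil => simp [occ_nil]
  | cons a s ih => simp [occ_cons, ih]

/-- The last term counts the occurrences that straddle the boundary: they start in one of the last
`w.length` positions of `u`. -/
theorem occ_append_le (w u v : List α) :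
    occ w (u ++ v) ≤ occ w u + occ w v + min u.length w.length := by
  induction u with
  | nil => simp
  | cons a u ih =>
    rw [List.cons_append, occ_cons, occ_cons]
    by_cases h : (a :: u).length ≤ w.length
    · simp only [List.length_cons] at h ⊢
      split_ifs <;> omega
    · have h1 : w <+: a :: (u ++ v) → w <+: a :: u := fun hw =>
        List.prefix_of_prefix_length_le hw (List.prefix_append (a :: u) v) (by omega)
      simp only [List.length_cons] at h ⊢
      split_ifs with h2 h3 h3
      · omega
      · exact absurd (h1 h2) h3
      · omega
      · omega

theorem occ_pos_of_infix {w s : List α} (h : w <:+: s) : 0 < occ w s := by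
  obtain ⟨t, h1, h2⟩ := List.infix_iff_prefix_suffix.1 h
  rw [occ, List.countP_pos_iff]
  exact ⟨t, (List.mem_tails _ _).2 h2, by simpa using h1⟩

/-- Each occurrence of `p` has a unique preceding character, except the one at the very beginning of
`l`. -/
theorem sum_occ_cons_add_le [Fintype α] (p l : List α) :
    ∑ a : α, occ (a :: p) l + (if p <+: l then 1 else 0) ≤ occ p l := by
  induction l with
  | nil => simp [occ_nil]
  | cons x l ih =>
    have : ∑ a : α, occ (a :: p) (x :: l) =
        ∑ a : α, occ (a :: p) l + if p <+: l then 1 else 0 := by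
      simp only [occ_cons, List.cons_prefix_cons, Finset.sum_add_distrib]
      congr 1
      by_cases h : p <+: l <;> simp [h]
    rw [this, occ_cons]
    omega

end Occurrences

/-! ### Followers of a context as occurrences of longer strings -/

section Followers

variable {σ : ℕ}

theorem append_singleton_prefix_iff {α : Type*} (w t : List α) (a : α) :
    w ++ [a] <+: t ↔ w <+: t ∧ t[w.length]? = some a := by
  constructor
  · rintro ⟨r, rfl⟩
    exact ⟨⟨a :: r, by simp⟩, by simp⟩
  · rintro ⟨⟨r, rfl⟩, h⟩
    cases r with
    | nil => simp at h
    | cons b r =>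
      simp at h
      exact ⟨r, by simp [h]⟩

theorem count_followers (w s : List (Fin σ)) (a : Fin σ) :
    (followers w s).count a = occ (w ++ [a]) s := by
  rw [followers, List.count, List.countP_filterMap, occ]
  apply List.countP_congr
  intro t _
  by_cases h : w <+: t
  · cases h' : t[w.length]? <;> simp [append_singleton_prefix_iff, h, h']
  · simp [append_singleton_prefix_iff, h]

theorem sum_count_eq_length (x : List (Fin σ)) : ∑ a, x.count a = x.length := by
  induction x with
  | nil => simp
  | cons b x ih => simp [List.count_cons, Finset.sum_add_distrib, ih]

theorem length_followers_le (w s : List (Fin σ)) : (followers w s).length ≤ occ w s := by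
  rw [followers, List.length_filterMap_eq_countP, occ]
  apply List.countP_mono_left
  intro t _ h
  by_contra h'
  simp at h'
  simp [h'] at h

open Classical in
theorem card_infix_le (w v : List (Fin σ)) :
    (Finset.univ.filter fun a : Fin σ => w ++ [a] <:+: v).card ≤ occ w v := by
  refine le_trans ?_ (length_followers_le w v)
  rw [← sum_count_eq_length, Finset.card_filter]
  refine Finset.sum_le_sum fun a _ => ?_
  split_ifs with h
  · rw [count_followers]
    exact occ_pos_of_infix h
  · exact Nat.zero_le _

end Followers

/-! ### Bounds on the empirical entropy -/

section Entropy

variable {σ : ℕ}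

/-- Gibbs' inequality for the empirical distribution. -/
theorem length_mul_entropy0_le (x : List (Fin σ)) (p : Fin σ → ℝ) (hp : ∀ a, 0 < p a)
    (hp1 : ∑ a, p a ≤ 1) :
    (x.length : ℝ) * entropy0 x ≤ ∑ a, (x.count a : ℝ) * -Real.logb 2 (p a) := by
  have hl2 : 0 < Real.log 2 := Real.log_pos (by norm_num)
  rcases Nat.eq_zero_or_pos x.length with h0 | h0
  · have : x = [] := List.eq_nil_of_length_eq_zero h0
    subst this
    simp
  have hN : (0 : ℝ) < x.length := by exact_mod_cast h0
  have key : ∀ a, (x.length : ℝ) * ((x.count a : ℝ) / x.length *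
      Real.logb 2 (x.length / x.count a)) - (x.count a : ℝ) * -Real.logb 2 (p a) ≤
      (x.length * p a - x.count a) / Real.log 2 := by
    intro a
    rcases Nat.eq_zero_or_pos (x.count a) with hc | hc
    · simp only [hc]
      have := hp a
      simp only [Nat.cast_zero, zero_div, div_zero, zero_mul, mul_zero, sub_zero]
      positivity
    · have hc' : (0 : ℝ) < x.count a := by exact_mod_cast hc
      have h1 : Real.log (x.length / x.count a * p a) ≤ x.length / x.count a * p a - 1 :=
        Real.log_le_sub_one_of_pos (mul_pos (div_pos hN hc') (hp a))
      rw [Real.log_mul (div_pos hN hc').ne' (hp a).ne'] at h1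
      have h2 := mul_le_mul_of_nonneg_left h1 hc'.le
      have h3 : (x.count a : ℝ) * (x.length / x.count a * p a - 1) =
          x.length * p a - x.count a := by field_simp
      rw [h3] at h2
      rw [le_div_iff₀ hl2]
      refine le_trans (le_of_eq ?_) h2
      rw [Real.logb, Real.logb]
      field_simp
      ring
  have hs := Finset.sum_le_sum fun a (_ : a ∈ Finset.univ) => key a
  rw [Finset.sum_sub_distrib, ← Finset.sum_div, Finset.sum_sub_distrib, ← Finset.mul_sum,
    ← Finset.mul_sum, ← Nat.cast_sum, sum_count_eq_length] at hs
  have : (x.length * ∑ a, p a - x.length) / Real.log 2 ≤ 0 :=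
    div_nonpos_of_nonpos_of_nonneg (by nlinarith) hl2.le
  rw [entropy0]
  linarith

open Classical in
/-- The entropy of a string whose characters mostly belong to a small set. -/
theorem length_mul_entropy0_le_of_card_le (x : List (Fin σ)) (D : Finset (Fin σ)) (d : ℕ)
    (hD : D.card ≤ d) :
    (x.length : ℝ) * entropy0 x ≤ ∑ a, (x.count a : ℝ) *
      (Real.logb 2 (d + 1) + if a ∈ D then 0 else Real.logb 2 σ) := by
  rcases Nat.eq_zero_or_pos σ with h0 | h0
  · subst h0
    simp [entropy0]
  have hs : (0 : ℝ) < σ := by exact_mod_cast h0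
  have hd : (0 : ℝ) < (d : ℝ) + 1 := by positivity
  -- Weight `1` on `D` and `1 / σ` elsewhere has total at most `d + 1`. So a character of `D` costs
  -- `log (d + 1)`, and any other one `log σ` more.
  refine (length_mul_entropy0_le x (fun a => (if a ∈ D then 1 else (σ : ℝ)⁻¹) / (d + 1))
    (fun a => by positivity) ?_).trans (le_of_eq ?_)
  · rw [← Finset.sum_div, div_le_one hd]
    have : ∀ a : Fin σ, (if a ∈ D then 1 else (σ : ℝ)⁻¹) ≤ (if a ∈ D then 1 else 0) + (σ : ℝ)⁻¹ := by
      intro a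
      have : (0 : ℝ) < (σ : ℝ)⁻¹ := by positivity
      split_ifs <;> linarith
    refine (Finset.sum_le_sum fun a _ => this a).trans ?_
    rw [Finset.sum_add_distrib]
    simp only [Finset.sum_ite_mem, Finset.univ_inter, Finset.sum_const, Finset.card_univ,
      Fintype.card_fin, nsmul_eq_mul, mul_one]
    rw [mul_inv_cancel₀ hs.ne']
    have : (D.card : ℝ) ≤ d := by exact_mod_cast hD
    linarith
  · refine Finset.sum_congr rfl fun a _ => ?_
    congr 1
    split_ifs
    · rw [one_div, Real.logb_inv]; ring
    · rw [Real.logb_div (by positivity) hd.ne', Real.logb_inv]; ring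

open Classical in
/-- The number of occurrences in `s` of strings of length `r` that are not substrings of `v`. -/
noncomputable def alien (r : ℕ) (v s : List (Fin σ)) : ℕ :=
  s.tails.countP fun t => r ≤ t.length ∧ ¬ t.take r <:+: v

open Classical in
theorem alien_cons (r : ℕ) (v : List (Fin σ)) (a : Fin σ) (s : List (Fin σ)) :
    alien r v (a :: s) = alien r v s +
      if r ≤ (a :: s).length ∧ ¬ (a :: s).take r <:+: v then 1 else 0 := by
  simp [alien, List.countP_cons]

theorem alien_append_le (r : ℕ) (v x s : List (Fin σ)) :
    alien r v (x ++ s) ≤ alien r v s + x.length := by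
  induction x with
  | nil => simp
  | cons a x ih =>
    rw [List.cons_append, alien_cons, List.length_cons (as := x)]
    split_ifs <;> omega

theorem alien_append_eq (r : ℕ) (v x s : List (Fin σ))
    (h : ∀ y, y ≠ [] → y <:+ x → r ≤ (y ++ s).length → (y ++ s).take r <:+: v) :
    alien r v (x ++ s) = alien r v s := by
  induction x with
  | nil => simp
  | cons a x ih =>
    rw [List.cons_append, alien_cons, ih fun y hy hyx => h y hy (hyx.trans (List.suffix_cons a x))]
    have := h (a :: x) (by simp) List.suffix_rfl
    rw [if_neg fun h' => h'.2 (this h'.1), add_zero]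

-- Each position of `s` starts at most one string of length `k + 1`; it pays `x`, and `y` on top if
-- that string is alien to `v`.
open Classical in
theorem sum_occ_mul_le (k : ℕ) (v s : List (Fin σ)) (x y : ℝ) (hx : 0 ≤ x) (hy : 0 ≤ y) :
    ∑ w : Fin k → Fin σ, ∑ a, (occ (List.ofFn w ++ [a]) s : ℝ) *
      (x + if List.ofFn w ++ [a] <:+: v then 0 else y) ≤
      s.length * x + alien (k + 1) v s * y := by
  induction s with
  | nil => simp [occ_nil]; positivity
  | cons c s ih =>
    have hstep : ∑ w : Fin k → Fin σ, ∑ a,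
        (if List.ofFn w ++ [a] <+: c :: s then (1 : ℝ) else 0) *
          (x + if List.ofFn w ++ [a] <:+: v then 0 else y) ≤
        x + (if k + 1 ≤ (c :: s).length ∧ ¬ (c :: s).take (k + 1) <:+: v then 1 else 0) * y := by
      by_cases hl : k + 1 ≤ (c :: s).length
      · set t := c :: s with ht
        have hmatch : ∀ (w : Fin k → Fin σ) (a : Fin σ), List.ofFn w ++ [a] <+: t ↔
            w = (fun i : Fin k => t[i.1]'(by omega)) ∧ a = t[k] := by
          intro w a
          constructor
          · intro h
            refine ⟨?_, ?_⟩
            · funext i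
              have := h.getElem (i := i.1) (by simp)
              rw [← this, List.getElem_append_left (by simp)]
              simp
            · have := h.getElem (i := k) (by simp)
              rw [← this]
              simp
          · rintro ⟨h1, h2⟩
            rw [List.prefix_iff_eq_take]
            apply List.ext_getElem
            · simp; omega
            · intro i hi1 hi2
              simp only [List.length_append, List.length_ofFn, List.length_singleton] at hi1
              rw [List.getElem_take, List.getElem_append]
              split_ifs with hi
              · simp [h1]
              · have : i = k := by simp at hi; omega
                subst this
                simp [h2]
        rw [Finset.sum_eq_single (fun i : Fin k => t[i.1]'(by omega)),
          Finset.sum_eq_single t[k]]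
        · have h1 := (hmatch _ _).2 ⟨rfl, rfl⟩
          have h2 := List.prefix_iff_eq_take.1 h1
          simp only [List.length_append, List.length_ofFn, List.length_singleton] at h2
          rw [if_pos h1, one_mul, ← h2]
          by_cases h3 : List.ofFn (fun i : Fin k => t[i.1]'(by omega)) ++ [t[k]] <:+: v
          · simp [h3]
          · rw [if_neg h3, if_pos ⟨hl, h3⟩, one_mul]
        · intro a _ ha
          rw [if_neg fun h => ha ((hmatch _ _).1 h).2, zero_mul]
        · simp
        · intro w _ hw
          refine Finset.sum_eq_zero fun a _ => ?_
          rw [if_neg fun h => hw ((hmatch _ _).1 h).1, zero_mul]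
        · simp
      · rw [if_neg fun h => hl h.1, zero_mul, add_zero]
        refine (le_of_eq (Finset.sum_eq_zero fun w _ => Finset.sum_eq_zero fun a _ => ?_)).trans hx
        rw [if_neg, zero_mul]
        intro h
        have := h.length_le
        simp only [List.length_append, List.length_ofFn, List.length_singleton] at this
        exact hl this
    have e1 : ∀ (w : Fin k → Fin σ) (a : Fin σ), (occ (List.ofFn w ++ [a]) (c :: s) : ℝ) *
        (x + if List.ofFn w ++ [a] <:+: v then 0 else y) =
        (occ (List.ofFn w ++ [a]) s : ℝ) * (x + if List.ofFn w ++ [a] <:+: v then 0 else y) +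
        (if List.ofFn w ++ [a] <+: c :: s then (1 : ℝ) else 0) *
          (x + if List.ofFn w ++ [a] <:+: v then 0 else y) := by
      intro w a
      rw [occ_cons]
      push_cast
      ring
    simp_rw [e1, Finset.sum_add_distrib]
    rw [alien_cons, List.length_cons]
    push_cast
    rw [List.length_cons] at hstep
    push_cast at hstep
    linarith

/-- A string has small entropy if nearly all of its substrings of length `k + 1` are substrings
of a fixed string `v` in which no string of length `k` occurs often. -/
theorem entropy_mul_length_le (k d : ℕ) (v s : List (Fin σ))
    (hd : ∀ w : List (Fin σ), w.length = k → occ w v ≤ d) :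
    entropy k s * s.length ≤
      s.length * Real.logb 2 (d + 1) + alien (k + 1) v s * Real.logb 2 σ := by
  classical
  have hx : 0 ≤ Real.logb 2 ((d : ℝ) + 1) :=
    Real.logb_nonneg (by norm_num) (by have : (0 : ℝ) ≤ d := by positivity
                                       linarith)
  have hy : 0 ≤ Real.logb 2 (σ : ℝ) := by
    rcases Nat.eq_zero_or_pos σ with h | h
    · simp [h]
    · exact Real.logb_nonneg (by norm_num) (by exact_mod_cast h)
  rcases Nat.eq_zero_or_pos s.length with h0 | h0
  · rw [h0]
    simp only [Nat.cast_zero, mul_zero, zero_mul, zero_add]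
    positivity
  rw [entropy, div_mul_cancel₀ _ (by positivity)]
  refine le_trans (Finset.sum_le_sum fun w _ => ?_) (sum_occ_mul_le k v s _ _ hx hy)
  refine (length_mul_entropy0_le_of_card_le _
    (Finset.univ.filter fun a : Fin σ => List.ofFn w ++ [a] <:+: v) d
    ((card_infix_le _ _).trans (hd _ (by simp)))).trans (le_of_eq ?_)
  refine Finset.sum_congr rfl fun a _ => ?_
  rw [count_followers]
  simp

end Entropy

/-! ### Many strings without frequent substrings -/

section Sparse

variable {σ : ℕ}

/-- Every string of length `j ≤ k` occurs at most `T q ^ (k - j)` times in `l`. -/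
def Sparse (k T q : ℕ) (l : List (Fin σ)) : Prop :=
  ∀ w : List (Fin σ), w.length ≤ k → occ w l ≤ T * q ^ (k - w.length)

-- Prepending `a` can only violate the bound for a string `a :: l.take j` with `j < k` that has
-- already reached it. As `l.take j` occurs at most `q` times as often as that bound allows, at most
-- `q` characters are bad for each `j`. This is why the bounds grow by factors of `q`.
open Classical in
theorem le_card_sparse_cons (k T q : ℕ) (hT : 0 < T) (hq : 0 < q) (l : List (Fin σ))
    (hl : Sparse k T q l) (hlen : l.length + 2 ≤ T * q ^ k) :
    σ - k * q ≤ (Finset.univ.filter fun a : Fin σ => Sparse k T q (a :: l)).card := by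
  let B : ℕ → Finset (Fin σ) := fun j => Finset.univ.filter fun a =>
    j ≤ l.length ∧ T * q ^ (k - (j + 1)) ≤ occ (a :: l.take j) l
  have hB : ∀ j ∈ Finset.range k, (B j).card ≤ q := by
    intro j hj
    rw [Finset.mem_range] at hj
    by_cases hjl : j ≤ l.length
    · have h1 : (B j).card * (T * q ^ (k - (j + 1))) ≤ ∑ a : Fin σ, occ (a :: l.take j) l := by
        rw [← smul_eq_mul]
        refine (Finset.card_nsmul_le_sum (B j) (fun a => occ (a :: l.take j) l) _ ?_).trans ?_
        · intro a ha
          exact (Finset.mem_filter.1 ha).2.2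
        · exact Finset.sum_le_sum_of_subset (Finset.subset_univ _)
      have h2 := sum_occ_cons_add_le (l.take j) l
      have h3 := hl (l.take j) (by simp; omega)
      rw [List.length_take, min_eq_left hjl] at h3
      have h4 : T * q ^ (k - j) = q * (T * q ^ (k - (j + 1))) := by
        rw [show k - j = k - (j + 1) + 1 by omega, pow_succ]
        ring
      have h5 : (B j).card * (T * q ^ (k - (j + 1))) ≤ q * (T * q ^ (k - (j + 1))) := by omega
      exact Nat.le_of_mul_le_mul_right h5 (by positivity)
    · have : B j = ∅ := by
        ext a
        simp [B, hjl]
      simp [this]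
  have hsub : Finset.univ \ (Finset.range k).biUnion B ⊆
      Finset.univ.filter fun a : Fin σ => Sparse k T q (a :: l) := by
    intro a ha
    rw [Finset.mem_sdiff, Finset.mem_biUnion] at ha
    rw [Finset.mem_filter]
    refine ⟨Finset.mem_univ _, fun w hw => ?_⟩
    rcases w with _ | ⟨c, w⟩
    -- The empty string occurs once more than there are characters, hence the `+ 2` in `hlen`.
    · rw [occ_nil_left, List.length_cons, List.length_nil, Nat.sub_zero]
      exact hlen
    rw [occ_cons]
    split_ifs with hp
    · obtain ⟨rfl, hwl⟩ := List.cons_prefix_cons.1 hp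
      have hw' : w = l.take w.length := List.prefix_iff_eq_take.1 hwl
      by_contra hcon
      refine ha.2 ⟨w.length, Finset.mem_range.2 (by simpa using hw), Finset.mem_filter.2
        ⟨Finset.mem_univ _, hwl.length_le, ?_⟩⟩
      rw [← hw']
      rw [List.length_cons] at hcon
      omega
    · exact hl _ hw
  refine le_trans ?_ (Finset.card_le_card hsub)
  have h1 : ((Finset.range k).biUnion B).card ≤ k * q := by
    refine Finset.card_biUnion_le.trans ((Finset.sum_le_sum hB).trans ?_)
    simp
  have h2 := Finset.le_card_sdiff ((Finset.range k).biUnion B) (Finset.univ : Finset (Fin σ))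
  rw [Finset.card_univ, Fintype.card_fin] at h2
  omega

theorem exists_many_sparse (k T q : ℕ) (hT : 0 < T) (hq : 0 < q) (i : ℕ) (hi : i + 1 ≤ T * q ^ k) :
    ∃ U : Finset (List (Fin σ)), (σ - k * q) ^ i ≤ U.card ∧
      ∀ l ∈ U, l.length = i ∧ Sparse k T q l := by
  classical
  induction i with
  | zero =>
    refine ⟨{[]}, by simp, ?_⟩
    simp only [Finset.mem_singleton, forall_eq, List.length_nil, true_and]
    intro w hw
    rw [occ_nil]
    split_ifs with h
    · subst h
      simpa using hi
    · exact Nat.zero_le _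
  | succ i ih =>
    obtain ⟨U, hU, hUl⟩ := ih (by omega)
    refine ⟨(U.sigma fun l => Finset.univ.filter fun a : Fin σ => Sparse k T q (a :: l)).image
      fun x => x.2 :: x.1, ?_, ?_⟩
    · rw [Finset.card_image_of_injective, Finset.card_sigma, pow_succ]
      · refine (Nat.mul_le_mul_right _ hU).trans ?_
        rw [← smul_eq_mul]
        refine Finset.card_nsmul_le_sum _ _ _ fun l hl => ?_
        exact le_card_sparse_cons k T q hT hq l (hUl l hl).2 (by rw [(hUl l hl).1]; omega)
      · rintro ⟨l, a⟩ ⟨l', a'⟩ h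
        simp only [List.cons.injEq] at h
        obtain ⟨rfl, rfl⟩ := h
        rfl
    · intro l hl
      obtain ⟨⟨l', a⟩, h, rfl⟩ := Finset.mem_image.1 hl
      rw [Finset.mem_sigma, Finset.mem_filter] at h
      exact ⟨by simp [(hUl l' h.1).1], h.2.2⟩

theorem Sparse.occ_append_self_le {k T q : ℕ} {u : List (Fin σ)} (hu : Sparse k T q u)
    (w : List (Fin σ)) (hw : w.length = k) : occ w (u ++ u) ≤ 2 * T + k := by
  have h1 := hu w hw.le
  rw [hw, Nat.sub_self, pow_zero, mul_one] at h1
  have h2 := occ_append_le w u u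
  omega

end Sparse

/-! ### Concatenations of blocks of equal length -/

section Blocks

variable {σ : ℕ}

/-- In a concatenation of blocks few substrings of length `k + 1` are not substrings of `u ++ u`
if few of the blocks differ from `u`. -/
theorem alien_flatten_le (k ℓ : ℕ) (hk : k ≤ ℓ) (u : List (Fin σ)) (hu : u.length = ℓ)
    (bs : List (List (Fin σ))) (hbs : ∀ x ∈ bs, x.length = ℓ) :
    alien (k + 1) (u ++ u) bs.flatten ≤ 2 * ℓ * bs.countP fun x => x ≠ u := by
  -- A block other than `u` pays for the windows starting in it and for those starting in the block
  -- before it. The added term reserves the second payment for the next block to be prepended.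
  suffices h : alien (k + 1) (u ++ u) bs.flatten + (if bs.head? = some u ∨ bs = [] then 0 else ℓ) ≤
      2 * ℓ * bs.countP fun x => x ≠ u by omega
  induction bs with
  | nil => simp [alien]
  | cons x bs ih =>
    have ih := ih fun y hy => hbs y (List.mem_cons_of_mem _ hy)
    have hx := hbs x List.mem_cons_self
    have happ := alien_append_le (k + 1) (u ++ u) x bs.flatten
    rw [List.flatten_cons, List.countP_cons]
    by_cases hxu : x = u
    · subst hxu
      simp only [List.head?_cons, true_or, if_true, ne_eq, not_true, decide_false,
        Bool.false_eq_true, if_false, add_zero]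
      split_ifs at ih with h
      · rw [alien_append_eq]
        · simpa using ih
        · intro y hy hyx hlen
          rcases h with h | h
          · obtain ⟨c, rfl⟩ : ∃ c, bs = x :: c := by
              cases bs with
              | nil => simp at h
              | cons z c => simp at h; exact ⟨c, by rw [h]⟩
            rw [List.flatten_cons, ← List.append_assoc, List.take_append_of_le_length]
            · refine (List.take_prefix _ _).isInfix.trans ?_
              obtain ⟨z, rfl⟩ := hyx
              exact ⟨z, [], by simp⟩
            -- A window starting in `x` uses at least one character of `x`, so at most `k ≤ ℓ` of
            -- what follows, and thus stays within two blocks.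
            · have := List.length_pos_iff.2 hy
              rw [List.length_append]
              omega
          · subst h
            rw [List.flatten_nil, List.append_nil]
            exact ((List.take_prefix _ _).isInfix.trans hyx.isInfix).trans
              (List.prefix_append x x).isInfix
      · refine le_trans ?_ ih
        omega
    · have : (decide (x ≠ u)) = true := by simpa using hxu
      rw [this]
      simp only [if_true]
      have h2 : (if (x :: bs).head? = some u ∨ x :: bs = [] then 0 else ℓ) = ℓ := by
        simp [hxu]
      rw [h2, mul_add]
      omega

theorem flatten_injective {α : Type*} (ℓ : ℕ) (hℓ : 0 < ℓ) (as bs : List (List α))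
    (ha : ∀ x ∈ as, x.length = ℓ) (hb : ∀ x ∈ bs, x.length = ℓ) (h : as.flatten = bs.flatten) :
    as = bs := by
  induction as generalizing bs with
  | nil =>
    cases bs with
    | nil => rfl
    | cons b bs =>
      have := hb b List.mem_cons_self
      rw [List.flatten_cons, List.flatten_nil, eq_comm, List.append_eq_nil_iff] at h
      rw [h.1, List.length_nil] at this
      omega
  | cons a as ih =>
    cases bs with
    | nil =>
      have := ha a List.mem_cons_self
      rw [List.flatten_cons, List.flatten_nil, List.append_eq_nil_iff] at h
      rw [h.1, List.length_nil] at this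
      omega
    | cons b bs =>
      rw [List.flatten_cons, List.flatten_cons] at h
      obtain ⟨h1, h2⟩ := List.append_inj h
        ((ha a List.mem_cons_self).trans (hb b List.mem_cons_self).symm)
      rw [h1, ih bs (fun x hx => ha x (List.mem_cons_of_mem _ hx))
        (fun x hx => hb x (List.mem_cons_of_mem _ hx)) h2]

end Blocks

/-! ### The encoding pass on concatenations of blocks -/

namespace Algorithm

variable {σ b : ℕ} (A : Algorithm σ b)

/-- The memory contents after a string has been read in the encoding pass. -/
def after (m : Memory b) (s : List (Fin σ)) : Memory b := s.foldl A.update m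

/-- The bits that are output while a string is read in the encoding pass. -/
def emitted : Memory b → List (Fin σ) → List Bool
  | _, [] => []
  | m, a :: s => A.emit m a ++ emitted (A.update m a) s

theorem after_append (m : Memory b) (s t : List (Fin σ)) :
    A.after m (s ++ t) = A.after (A.after m s) t := by
  simp [after]

theorem encodeFrom_append (m : Memory b) (s t : List (Fin σ)) :
    A.encodeFrom m (s ++ t) = A.emitted m s ++ A.encodeFrom (A.after m s) t := by
  induction s generalizing m with
  | nil => simp [emitted, after]
  | cons a s ih => simp [encodeFrom, emitted, after, ih]

theorem exists_encodeFrom_of_run (s : List (Fin σ)) (p : Phase b) (w : List Bool)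
    (h : A.Run s p w) : ∃ m, w = A.encodeFrom m s := by
  induction h with
  | encode m => exact ⟨m, rfl⟩
  | scan m w _ ih => exact ih

variable {A}

/-- All that the preliminary passes contribute is the value `μ s`, one of `2 ^ b`. -/
theorem Lossless.exists_start (hA : A.Lossless) :
    ∃ μ : List (Fin σ) → Memory b, ∀ s, A.Stores s (A.encodeFrom (μ s) s) := by
  have : ∀ s, ∃ m, A.Stores s (A.encodeFrom m s) := by
    intro s
    obtain ⟨w, hw⟩ := hA.1 s
    obtain ⟨m, rfl⟩ := A.exists_encodeFrom_of_run s _ w hw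
    exact ⟨m, hw⟩
  choose μ hμ using this
  exact ⟨μ, hμ⟩

variable (A)

/-- There is a block that, read in any state, either makes the algorithm output more than `L` bits
or has the same effect as another block. -/
theorem exists_block {β : Type*} [Fintype β] (c : β → List (Fin σ)) (L : ℕ)
    (hL : 2 ^ b * (2 ^ b * 2 ^ (L + 1)) ≤ Fintype.card β) :
    ∃ u : β, ∀ q, (A.emitted q (c u)).length ≤ L →
      ∃ v, v ≠ u ∧ A.after q (c v) = A.after q (c u) ∧ A.emitted q (c v) = A.emitted q (c u) := by
  by_contra! hcon
  choose q hq hv using hcon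
  -- If every block had a state in which it is cheap and its effect unique, then the state before,
  -- the state after and the short output would identify the block.
  let F : β → Memory b × Memory b × (Σ i : Fin (L + 1), List.Vector Bool i) := fun u =>
    (q u, A.after (q u) (c u), ⟨⟨_, Nat.lt_succ_of_le (hq u)⟩, ⟨A.emitted (q u) (c u), rfl⟩⟩)
  have hF : Function.Injective F := by
    intro u v h
    by_contra hne
    have h1 : q u = q v := congrArg Prod.fst h
    have h2 : A.after (q u) (c u) = A.after (q v) (c v) := congrArg (fun x => x.2.1) h
    have h3 : A.emitted (q u) (c u) = A.emitted (q v) (c v) :=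
      congrArg (fun x : Memory b × Memory b × (Σ i : Fin (L + 1), List.Vector Bool i) =>
        x.2.2.2.toList) h
    rw [h1] at h2 h3
    exact hv v u hne h2 h3
  have hcard := Fintype.card_le_of_injective F hF
  have hs : ∑ i : Fin (L + 1), 2 ^ (i : ℕ) < 2 ^ (L + 1) := by
    rw [Fin.sum_univ_eq_sum_range (fun i => 2 ^ i)]
    exact Nat.geomSum_lt (by norm_num) (by simp)
  simp only [Fintype.card_prod, Fintype.card_sigma, card_vector, Fintype.card_bool,
    Fintype.card_pi, Finset.prod_const, Finset.card_univ, Fintype.card_fin] at hcard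
  have h2 : 2 ^ b * (2 ^ b * ∑ i : Fin (L + 1), 2 ^ (i : ℕ)) < 2 ^ b * (2 ^ b * 2 ^ (L + 1)) := by
    gcongr
  omega

end Algorithm

/-! ### Sequences of blocks and the change of a single block -/

section Words

variable {α β : Type*}

/-- The concatenation of a sequence of blocks. -/
def word (c : β → List α) {K : ℕ} (t : Fin K → β) : List α := (List.ofFn fun i => c (t i)).flatten

/-- The concatenation of the first `i` blocks of a sequence. -/
def wordTake (c : β → List α) {K : ℕ} (t : Fin K → β) (i : ℕ) : List α :=
  ((List.ofFn fun i => c (t i)).take i).flatten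

theorem word_eq (c : β → List α) {K : ℕ} (t : Fin K → β) (i : Fin K) :
    word c t = wordTake c t i ++
      (c (t i) ++ ((List.ofFn fun i => c (t i)).drop (i + 1)).flatten) := by
  have h : (List.ofFn fun i => c (t i)) = (List.ofFn fun i => c (t i)).take i ++
      (c (t i) :: (List.ofFn fun i => c (t i)).drop (i + 1)) := by
    conv_lhs => rw [← List.take_append_drop i (List.ofFn fun i => c (t i))]
    rw [List.drop_eq_getElem_cons (by simp)]
    simp
  rw [word, wordTake]
  conv_lhs => rw [h]
  simp

theorem word_update_eq [DecidableEq β] (c : β → List α) {K : ℕ} (t : Fin K → β) (i : Fin K)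
    (v : β) :
    word c (Function.update t i v) = wordTake c t i ++
      (c v ++ ((List.ofFn fun i => c (t i)).drop (i + 1)).flatten) := by
  have h1 : (List.ofFn fun i' => c (Function.update t i v i')).take i =
      (List.ofFn fun i => c (t i)).take i := by
    apply List.ext_getElem
    · simp
    · intro n h1 h2
      simp only [List.getElem_take, List.getElem_ofFn]
      rw [Function.update_of_ne]
      intro h
      simp at h1
      have := congrArg Fin.val h
      simp at this
      omega
  have h2 : (List.ofFn fun i' => c (Function.update t i v i')).drop (i + 1) =
      (List.ofFn fun i => c (t i)).drop (i + 1) := by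
    apply List.ext_getElem
    · simp
    · intro n h1 h2
      simp only [List.getElem_drop, List.getElem_ofFn]
      rw [Function.update_of_ne]
      intro h
      have := congrArg Fin.val h
      simp at this
      omega
  rw [word_eq c _ i, wordTake, wordTake, Function.update_self, h1, h2]

theorem length_word (c : β → List α) (ℓ : ℕ) (hc : ∀ v, (c v).length = ℓ) {K : ℕ}
    (t : Fin K → β) : (word c t).length = K * ℓ := by
  simp [word, List.length_flatten, List.map_ofFn, Function.comp_def, hc]

theorem word_injective (c : β → List α) (hinj : Function.Injective c) (ℓ : ℕ) (hℓ : 0 < ℓ)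
    (hc : ∀ v, (c v).length = ℓ) (K : ℕ) :
    Function.Injective (word c : (Fin K → β) → List α) := by
  intro s t h
  have := flatten_injective ℓ hℓ _ _ (by simp [List.mem_ofFn, hc]) (by simp [List.mem_ofFn, hc]) h
  have := List.ofFn_injective this
  funext i
  exact hinj (congrFun this i)

theorem countP_ofFn (p : α → Prop) [DecidablePred p] {K : ℕ} (t : Fin K → α) :
    (List.ofFn t).countP (fun a => p a) = (Finset.univ.filter fun i => p (t i)).card := by
  induction K with
  | zero => simp
  | succ K ih =>
    rw [List.ofFn_succ, List.countP_cons, ih, Finset.card_filter, Finset.card_filter,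
      Fin.sum_univ_succ, add_comm]
    simp

end Words

/-! ### Exchanging a block within the encoding pass -/

namespace Algorithm

variable {σ b : ℕ} (A : Algorithm σ b) {β : Type*} (c : β → List (Fin σ))

theorem encodeFrom_word_update [DecidableEq β] (m : Memory b) {K : ℕ} (t : Fin K → β) (i : Fin K)
    (v : β) (h1 : A.after (A.after m (wordTake c t i)) (c v) =
      A.after (A.after m (wordTake c t i)) (c (t i)))
    (h2 : A.emitted (A.after m (wordTake c t i)) (c v) =
      A.emitted (A.after m (wordTake c t i)) (c (t i))) :
    A.encodeFrom m (word c (Function.update t i v)) = A.encodeFrom m (word c t) := by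
  rw [word_update_eq, word_eq c t i]
  simp only [encodeFrom_append, h1, h2]

theorem sum_length_emitted_le (m : Memory b) {K : ℕ} (t : Fin K → β) :
    ∑ i : Fin K, (A.emitted (A.after m (wordTake c t i)) (c (t i))).length ≤
      (A.encodeFrom m (word c t)).length := by
  induction K generalizing m with
  | zero => simp
  | succ K ih =>
    have h1 : word c t = c (t 0) ++ word c fun i => t i.succ := by
      simp [word, List.ofFn_succ]
    have h2 : ∀ i : Fin K, wordTake c t i.succ = c (t 0) ++ wordTake c (fun i => t i.succ) i := by
      intro i
      simp [wordTake, List.ofFn_succ]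
    have h3 : wordTake c t (0 : Fin (K + 1)) = [] := by simp [wordTake]
    rw [h1, encodeFrom_append, List.length_append, Fin.sum_univ_succ, h3]
    refine Nat.add_le_add (by simp [after]) ?_
    simp only [h2, after_append]
    exact ih _ _

end Algorithm

/-! ### Sequences with a given number of deviations from a block -/

section Layers

variable {β : Type*} [Fintype β] [DecidableEq β]

/-- The sequences of `K` blocks of which exactly `j` differ from `u`. -/
def layer (u : β) (K j : ℕ) : Finset (Fin K → β) :=
  Finset.univ.filter fun t => (Finset.univ.filter fun i => t i ≠ u).card = j

theorem mem_layer {u : β} {K j : ℕ} {t : Fin K → β} :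
    t ∈ layer u K j ↔ (Finset.univ.filter fun i => t i ≠ u).card = j := by
  simp [layer]

theorem update_mem_layer_succ {u : β} {K j : ℕ} {t : Fin K → β} (ht : t ∈ layer u K j)
    {i : Fin K} (hi : t i = u) {v : β} (hv : v ≠ u) :
    Function.update t i v ∈ layer u K (j + 1) := by
  rw [mem_layer] at ht ⊢
  have : (Finset.univ.filter fun i' => Function.update t i v i' ≠ u) =
      insert i (Finset.univ.filter fun i => t i ≠ u) := by
    ext i'
    by_cases h : i' = i
    · subst h; simp [hv]
    · simp [h]
  rw [this, Finset.card_insert_of_notMem (by simp [hi]), ht]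

theorem update_mem_layer {u : β} {K j : ℕ} {t : Fin K → β} (ht : t ∈ layer u K (j + 1))
    {i : Fin K} (hi : t i ≠ u) : Function.update t i u ∈ layer u K j := by
  rw [mem_layer] at ht ⊢
  have : (Finset.univ.filter fun i' => Function.update t i u i' ≠ u) =
      (Finset.univ.filter fun i => t i ≠ u).erase i := by
    ext i'
    by_cases h : i' = i
    · subst h; simp
    · simp [h]
  rw [this, Finset.card_erase_of_mem (by simp [hi]), ht, Nat.add_sub_cancel]

theorem layer_nonempty {u v : β} (hv : v ≠ u) {K j : ℕ} (hj : j ≤ K) : (layer u K j).Nonempty := by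
  induction j with
  | zero => exact ⟨fun _ => u, by simp [mem_layer]⟩
  | succ j ih =>
    obtain ⟨t, ht⟩ := ih (by omega)
    have : ∃ i, t i = u := by
      by_contra! h
      rw [mem_layer, Finset.filter_true_of_mem fun i _ => h i] at ht
      simp at ht
      omega
    obtain ⟨i, hi⟩ := this
    exact ⟨_, update_mem_layer_succ ht hi hv⟩

/-- Double counting: resetting one of the `j + 1` deviating blocks to `u` can be undone once the
position and the old block are known. -/
theorem card_layer_succ_mul_le (u : β) (K j : ℕ) :
    (layer u K (j + 1)).card * (j + 1) ≤ (layer u K j).card * (K * Fintype.card β) := by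
  have h1 : ((layer u K (j + 1)).sigma fun t => Finset.univ.filter fun i => t i ≠ u).card =
      (layer u K (j + 1)).card * (j + 1) := by
    rw [Finset.card_sigma, Finset.sum_const_nat fun t ht => mem_layer.1 ht]
  have h2 : (layer u K j ×ˢ (Finset.univ : Finset (Fin K × β))).card =
      (layer u K j).card * (K * Fintype.card β) := by
    simp [Finset.card_product]
  rw [← h1, ← h2]
  refine Finset.card_le_card_of_injOn (fun x => (Function.update x.1 x.2 u, x.2, x.1 x.2)) ?_ ?_
  · rintro ⟨t, i⟩ h
    simp only [Finset.coe_sigma, Set.mem_sigma_iff, Finset.mem_coe, Finset.mem_filter,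
      Finset.mem_univ, true_and] at h
    simp only [Finset.coe_product, Finset.coe_univ, Set.mem_prod, Finset.mem_coe, Set.mem_univ,
      and_true]
    exact update_mem_layer h.1 h.2
  · rintro ⟨t, i⟩ _ ⟨t', i'⟩ _ h
    simp only [Prod.mk.injEq] at h
    obtain ⟨h1, rfl, h3⟩ := h
    have : t = t' := by
      have h4 := congrArg (fun s => Function.update s i (t i)) h1
      simp only [Function.update_idem, Function.update_eq_self] at h4
      rw [h4, h3, Function.update_eq_self]
    rw [this]

end Layers

/-! ### Counting exchanges against losslessness -/

namespace Algorithm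

variable {σ b : ℕ} {A : Algorithm σ b} {β : Type*} [Fintype β] [DecidableEq β]

/-- Some concatenation of blocks nearly all of which are equal to `u` has a long output. -/
theorem Lossless.exists_long_output (hA : A.Lossless) (c : β → List (Fin σ))
    (hinj : Function.Injective c) (ℓ : ℕ) (hℓ : 0 < ℓ) (hc : ∀ v, (c v).length = ℓ) (L : ℕ)
    (u v₀ : β) (hv₀ : v₀ ≠ u)
    (hu : ∀ q, (A.emitted q (c u)).length ≤ L →
      ∃ v, v ≠ u ∧ A.after q (c v) = A.after q (c u) ∧ A.emitted q (c v) = A.emitted q (c u))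
    (K j : ℕ) (hj : j ≤ K) :
    ∃ t ∈ layer u K j, ∃ w S, A.Stores (word c t) w ∧
      S * (j + 1) ≤ 2 ^ b * (K * Fintype.card β) ∧
      K * (L + 1) ≤ w.length + (j + S) * (L + 1) := by
  obtain ⟨μ, hμ⟩ := hA.exists_start
  let q : (Fin K → β) → Fin K → Memory b := fun t i => A.after (μ (word c t)) (wordTake c t i)
  let P : (Fin K → β) → Finset (Fin K) := fun t =>
    Finset.univ.filter fun i => t i = u ∧ (A.emitted (q t i) (c u)).length ≤ L
  have hex : ∀ r : Memory b, ∃ v, v ≠ u ∧ ((A.emitted r (c u)).length ≤ L →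
      A.after r (c v) = A.after r (c u) ∧ A.emitted r (c v) = A.emitted r (c u)) := by
    intro r
    by_cases h : (A.emitted r (c u)).length ≤ L
    · obtain ⟨v, hv, h1⟩ := hu r h
      exact ⟨v, hv, fun _ => h1⟩
    · exact ⟨v₀, hv₀, fun h' => absurd h' h⟩
  choose alt halt1 halt2 using hex
  -- The pair of exchanged sequence and original start determines `(t, i)`: running the encoding
  -- pass on it reproduces the output stored for `t`, hence `t` by losslessness, and `i` is the
  -- position where the two sequences differ.
  have hcount : ∑ t ∈ layer u K j, (P t).card ≤ (layer u K (j + 1)).card * 2 ^ b := by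
    have h2 : (layer u K (j + 1) ×ˢ (Finset.univ : Finset (Memory b))).card =
        (layer u K (j + 1)).card * 2 ^ b := by
      simp [Finset.card_product]
    rw [← h2, ← Finset.card_sigma]
    refine Finset.card_le_card_of_injOn
      (fun x => (Function.update x.1 x.2 (alt (q x.1 x.2)), μ (word c x.1))) ?_ ?_
    · rintro ⟨t, i⟩ h
      simp only [Finset.coe_sigma, Set.mem_sigma_iff, Finset.mem_coe] at h
      simp only [Finset.coe_product, Finset.coe_univ, Set.mem_prod, Finset.mem_coe, Set.mem_univ,
        and_true]
      exact update_mem_layer_succ h.1 (Finset.mem_filter.1 h.2).2.1 (halt1 _)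
    · have hsame : ∀ (t : Fin K → β) (i : Fin K), i ∈ P t →
          A.encodeFrom (μ (word c t)) (word c (Function.update t i (alt (q t i)))) =
            A.encodeFrom (μ (word c t)) (word c t) := by
        intro t i hi
        obtain ⟨h1, h2⟩ := (Finset.mem_filter.1 hi).2
        refine A.encodeFrom_word_update c _ t i _ ?_ ?_
        · rw [h1]; exact (halt2 _ h2).1
        · rw [h1]; exact (halt2 _ h2).2
      rintro ⟨t, i⟩ h ⟨t', i'⟩ h' heq
      simp only [Finset.coe_sigma, Set.mem_sigma_iff, Finset.mem_coe] at h h'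
      simp only [Prod.mk.injEq] at heq
      obtain ⟨h1, h2⟩ := heq
      have e1 := hsame t i h.2
      have e2 := hsame t' i' h'.2
      rw [h1, h2, e2] at e1
      have e3 : word c t = word c t' := by
        refine hA.2 _ _ _ ?_ (hμ _) ?_
        · rw [length_word c ℓ hc, length_word c ℓ hc]
        · rw [h2, ← e1]
          exact h2 ▸ hμ (word c t')
      have e4 := word_injective c hinj ℓ hℓ hc K e3
      subst e4
      have : i = i' := by
        by_contra hne
        have h3 := congrFun h1 i
        rw [Function.update_self, Function.update_of_ne hne,
          (Finset.mem_filter.1 h.2).2.1] at h3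
        exact halt1 _ h3
      rw [this]
  have hlayer := card_layer_succ_mul_le u K j
  -- Some sequence has no more cheap positions than the average over its layer.
  obtain ⟨t, ht, htS⟩ : ∃ t ∈ layer u K j,
      (P t).card * (j + 1) ≤ 2 ^ b * (K * Fintype.card β) := by
    by_contra! hcon
    have h1 := Finset.sum_lt_sum_of_nonempty (layer_nonempty hv₀ hj) hcon
    rw [Finset.sum_const, smul_eq_mul, ← Finset.sum_mul] at h1
    have h2 := Nat.mul_le_mul_right (j + 1) hcount
    have h3 := Nat.mul_le_mul_right (2 ^ b) hlayer
    have h4 : (layer u K (j + 1)).card * 2 ^ b * (j + 1) =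
        (layer u K (j + 1)).card * (j + 1) * 2 ^ b := by ring
    have h5 : (layer u K j).card * (K * Fintype.card β) * 2 ^ b =
        (layer u K j).card * (2 ^ b * (K * Fintype.card β)) := by ring
    omega
  refine ⟨t, ht, _, (P t).card, hμ _, htS, ?_⟩
  have hsum := A.sum_length_emitted_le c (μ (word c t)) t
  -- Each position deviates, is cheap, or emits at least `L + 1` bits.
  have hcover : (Finset.univ : Finset (Fin K)) ⊆ ((Finset.univ.filter fun i => t i ≠ u) ∪ P t) ∪
      Finset.univ.filter fun i => L + 1 ≤ (A.emitted (q t i) (c (t i))).length := by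
    intro i _
    by_cases h1 : t i = u
    · by_cases h2 : (A.emitted (q t i) (c u)).length ≤ L
      · simp [P, h1, h2]
      · simp [h1]
        omega
    · simp [h1]
  have hcard := Finset.card_le_card hcover
  rw [Finset.card_univ, Fintype.card_fin] at hcard
  have h1 := Finset.card_union_le ((Finset.univ.filter fun i => t i ≠ u) ∪ P t)
    (Finset.univ.filter fun i => L + 1 ≤ (A.emitted (q t i) (c (t i))).length)
  have h2 := Finset.card_union_le (Finset.univ.filter fun i => t i ≠ u) (P t)
  rw [mem_layer.1 ht] at h2
  have h3 : (Finset.univ.filter fun i => L + 1 ≤ (A.emitted (q t i) (c (t i))).length).card *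
      (L + 1) ≤ ∑ i : Fin K, (A.emitted (q t i) (c (t i))).length := by
    rw [← smul_eq_mul]
    refine (Finset.card_nsmul_le_sum _
      (fun i => (A.emitted (q t i) (c (t i))).length) _ ?_).trans
      (Finset.sum_le_sum_of_subset (Finset.subset_univ _))
    intro i hi
    exact (Finset.mem_filter.1 hi).2
  have h4 := Nat.mul_le_mul_right (L + 1) (hcard.trans (h1.trans (Nat.add_le_add_right h2 _)))
  rw [add_mul] at h4
  have h5 := h3.trans hsum
  omega

/-- For fixed parameters: arbitrarily long strings with small entropy and a long output. -/
theorem Lossless.exists_incompressible (hA : A.Lossless) (k T q ℓ L : ℕ) (hT : 0 < T) (hq : 0 < q)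
    (hℓ : 0 < ℓ) (hkℓ : k ≤ ℓ) (hℓT : ℓ + 1 ≤ T * q ^ k)
    (hL : 2 ^ b * (2 ^ b * 2 ^ (L + 1)) ≤ (σ - k * q) ^ ℓ) :
    ∃ N : ℕ, ∀ K j, j ≤ K → ∃ s w S, s.length = K * ℓ ∧ A.Stores s w ∧
      entropy k s * s.length ≤ s.length * Real.logb 2 ((2 * T + k : ℕ) + 1) +
        (2 * ℓ * j : ℕ) * Real.logb 2 σ ∧
      S * (j + 1) ≤ N * K ∧ K * (L + 1) ≤ w.length + (j + S) * (L + 1) := by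
  obtain ⟨U, hU, hUl⟩ := exists_many_sparse (σ := σ) k T q hT hq ℓ hℓT
  have hcardU : Fintype.card U = U.card := Fintype.card_coe U
  obtain ⟨u, hu⟩ := A.exists_block (fun x : U => x.1) L (by rw [hcardU]; exact hL.trans hU)
  obtain ⟨v₀, hv₀⟩ : ∃ v₀, v₀ ≠ u := by
    refine Fintype.exists_ne_of_one_lt_card ?_ u
    rw [hcardU]
    refine lt_of_lt_of_le ?_ (hL.trans hU)
    rw [← pow_add, ← pow_add]
    exact Nat.one_lt_two_pow (by omega)
  refine ⟨2 ^ b * Fintype.card U, fun K j hj => ?_⟩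
  obtain ⟨t, ht, w, S, hw, hS, hlen⟩ := hA.exists_long_output (fun x : U => x.1)
    Subtype.val_injective ℓ hℓ (fun v => (hUl _ v.2).1) L u v₀ hv₀ hu K j hj
  have hl := length_word (fun x : U => x.1) ℓ (fun v => (hUl _ v.2).1) t
  refine ⟨_, w, S, hl, hw, ?_, by rwa [mul_assoc, mul_comm (Fintype.card U)], hlen⟩
  refine (entropy_mul_length_le k (2 * T + k) (u.1 ++ u.1) _ fun x hx =>
    (hUl _ u.2).2.occ_append_self_le x hx).trans ?_
  have h1 := alien_flatten_le k ℓ hkℓ u.1 (hUl _ u.2).1 (List.ofFn fun i => (t i).1)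
    (fun x hx => by
      obtain ⟨i, rfl⟩ := List.mem_ofFn.1 hx
      exact (hUl _ (t i).2).1)
  rw [countP_ofFn (fun x => x ≠ u.1)] at h1
  have h2 : (Finset.univ.filter fun i => (t i).1 ≠ u.1).card = j := by
    rw [← mem_layer.1 ht]
    exact congrArg Finset.card (Finset.filter_congr fun i _ => not_congr Subtype.ext_iff.symm)
  rw [h2] at h1
  have hσ : 0 ≤ Real.logb 2 (σ : ℝ) := by
    rcases Nat.eq_zero_or_pos σ with h | h
    · simp [h]
    · exact Real.logb_nonneg (by norm_num) (by exact_mod_cast h)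
  have h3 : (alien (k + 1) (u.1 ++ u.1) (word (fun x : U => x.1) t) : ℝ) ≤ (2 * ℓ * j : ℕ) := by
    exact_mod_cast h1
  gcongr

end Algorithm

/-! ### The choice of the parameters -/

section Parameters

/-- The right side becomes `ℓ + 1`, so blocks are longer than `2 * b + k`. It has order `σ ^ (k +
α)`, which beats the memory by a factor `σ ^ θ` up to constants. -/
theorem eventually_two_mul_add_le (k : ℕ) (α θ : ℝ) (hα : 0 < α) (hθ : 0 < θ) (b : ℕ → ℕ)
    (hb : (fun σ : ℕ => (b σ : ℝ)) =O[atTop] fun σ : ℕ => (σ : ℝ) ^ ((k : ℝ) + α - θ)) :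
    ∀ᶠ σ : ℕ in atTop, 2 * b σ + k + 2 ≤ ⌊(σ : ℝ) ^ α⌋₊ * (σ / (2 * k + 2)) ^ k := by
  have hγ : 0 < (k : ℝ) + α := by positivity
  have hcast : Tendsto (fun σ : ℕ => (σ : ℝ)) atTop atTop := tendsto_natCast_atTop_atTop
  have h1 : (fun σ : ℕ => (σ : ℝ) ^ ((k : ℝ) + α - θ)) =o[atTop]
      fun σ : ℕ => (σ : ℝ) ^ ((k : ℝ) + α) := by
    have hpos : ∀ᶠ σ : ℕ in atTop, (0 : ℝ) < σ := hcast.eventually_gt_atTop 0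
    refine isLittleO_of_tendsto' (hpos.mono fun σ hσ h => absurd h (by positivity))
      (((tendsto_rpow_neg_atTop hθ).comp hcast).congr' (hpos.mono fun σ hσ => ?_))
    simp only [Function.comp_apply]
    rw [← Real.rpow_sub hσ]
    congr 1
    ring
  have h2 : (fun σ : ℕ => (b σ : ℝ)) =o[atTop] fun σ : ℕ => (σ : ℝ) ^ ((k : ℝ) + α) :=
    hb.trans_isLittleO h1
  have h3 : (fun _ : ℕ => (k : ℝ) + 2) =o[atTop] fun σ : ℕ => (σ : ℝ) ^ ((k : ℝ) + α) :=
    isLittleO_const_left.2 (Or.inr (tendsto_norm_atTop_atTop.comp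
      ((tendsto_rpow_atTop hγ).comp hcast)))
  -- The constant absorbs the roundings: a factor `2` for `⌊σ ^ α⌋₊`, and `4 * k + 4` in place of `2
  -- * k + 2` for the integer quotient.
  have h4 := ((h2.const_mul_left 2).add h3).def
    (show (0 : ℝ) < 1 / (2 * (4 * k + 4) ^ k) by positivity)
  have h5 : ∀ᶠ σ : ℕ in atTop, (2 : ℝ) ≤ (σ : ℝ) ^ α :=
    ((tendsto_rpow_atTop hα).comp hcast).eventually_ge_atTop 2
  filter_upwards [h4, h5, eventually_ge_atTop (4 * k + 4)] with σ h4 h5 h6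
  have hσ : (0 : ℝ) < σ := by
    have : 0 < σ := by omega
    exact_mod_cast this
  have h7 : (σ : ℝ) ^ α / 2 ≤ (⌊(σ : ℝ) ^ α⌋₊ : ℝ) := by
    have := Nat.lt_floor_add_one ((σ : ℝ) ^ α)
    linarith
  have h8 : (σ : ℝ) / (4 * k + 4) ≤ ((σ / (2 * k + 2) : ℕ) : ℝ) := by
    rw [div_le_iff₀ (by positivity)]
    have h9 := Nat.div_add_mod σ (2 * k + 2)
    have h10 := Nat.mod_lt σ (show 0 < 2 * k + 2 by omega)
    have h11 : 1 ≤ σ / (2 * k + 2) := by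
      rw [Nat.one_le_div_iff (by omega)]
      omega
    have h12 : σ ≤ σ / (2 * k + 2) * (4 * k + 4) := by nlinarith
    exact_mod_cast h12
  have h13 : 1 / (2 * (4 * (k : ℝ) + 4) ^ k) * (σ : ℝ) ^ ((k : ℝ) + α) ≤
      (⌊(σ : ℝ) ^ α⌋₊ : ℝ) * ((σ / (2 * k + 2) : ℕ) : ℝ) ^ k := by
    refine le_trans (le_of_eq ?_) (mul_le_mul h7 (pow_le_pow_left₀ (by positivity) h8 k)
      (by positivity) (by positivity))
    rw [Real.rpow_add hσ, Real.rpow_natCast, div_pow]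
    field_simp
  rw [Real.norm_of_nonneg (by positivity), Real.norm_of_nonneg (by positivity)] at h4
  have h14 : (2 * b σ + k + 2 : ℝ) ≤
      (⌊(σ : ℝ) ^ α⌋₊ : ℝ) * ((σ / (2 * k + 2) : ℕ) : ℝ) ^ k := by linarith
  exact_mod_cast h14

theorem tendsto_logb_natCast : Tendsto (fun σ : ℕ => Real.logb 2 (σ : ℝ)) atTop atTop :=
  (Real.tendsto_logb_atTop (by norm_num)).comp tendsto_natCast_atTop_atTop

theorem eventually_logb_le (k : ℕ) (α θ : ℝ) (hα : 0 < α) (hθ : 0 < θ) :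
    ∀ᶠ σ : ℕ in atTop, Real.logb 2 ((2 * ⌊(σ : ℝ) ^ α⌋₊ + k : ℕ) + 1) ≤
      (α + θ) * Real.logb 2 σ := by
  filter_upwards [(tendsto_logb_natCast.const_mul_atTop hθ).eventually_ge_atTop
    (Real.logb 2 (k + 3)), eventually_ge_atTop 1] with σ h1 h2
  have hσ : (1 : ℝ) ≤ σ := by exact_mod_cast h2
  have h3 : 1 ≤ (σ : ℝ) ^ α := Real.one_le_rpow hσ hα.le
  have h4 : (⌊(σ : ℝ) ^ α⌋₊ : ℝ) ≤ (σ : ℝ) ^ α := Nat.floor_le (by positivity)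
  have hk : (0 : ℝ) ≤ k := by positivity
  calc Real.logb 2 ((2 * ⌊(σ : ℝ) ^ α⌋₊ + k : ℕ) + 1)
      ≤ Real.logb 2 ((k + 3) * (σ : ℝ) ^ α) := by
        apply Real.logb_le_logb_of_le (by norm_num) (by positivity)
        push_cast
        nlinarith
    _ = Real.logb 2 (k + 3) + α * Real.logb 2 σ := by
        rw [Real.logb_mul (by positivity) (by positivity),
          Real.logb_rpow_eq_mul_logb_of_pos (by linarith)]
    _ ≤ (α + θ) * Real.logb 2 σ := by linarith

/-- At least `σ / 2` choices per character give `ℓ * (log σ - 1)` bits. The slack `η * ℓ * log σ ≥ 2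
* ℓ` pays for this `ℓ` and for `2 * b + 1 ≤ ℓ`. -/
theorem two_pow_le_sub_pow (σ b k ℓ : ℕ) (η : ℝ) (hη : η ≤ 1) (hσ : 2 * k + 2 ≤ σ)
    (hb : 2 * b + 1 ≤ ℓ) (hlog : 2 ≤ η * Real.logb 2 σ) :
    2 ^ b * (2 ^ b * 2 ^ (⌊(1 - η) * (ℓ * Real.logb 2 σ)⌋₊ + 1)) ≤
      (σ - k * (σ / (2 * k + 2))) ^ ℓ := by
  set L := ⌊(1 - η) * (ℓ * Real.logb 2 σ)⌋₊ with hL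
  have hσ0 : (0 : ℝ) < σ := by
    have : 0 < σ := by omega
    exact_mod_cast this
  have hlog0 : 0 ≤ Real.logb 2 (σ : ℝ) :=
    Real.logb_nonneg (by norm_num) (by exact_mod_cast (by omega : 1 ≤ σ))
  have h1 : (σ : ℝ) / 2 ≤ ((σ - k * (σ / (2 * k + 2)) : ℕ) : ℝ) := by
    have h2 : (2 * k + 2) * (σ / (2 * k + 2)) ≤ σ := Nat.mul_div_le σ (2 * k + 2)
    have h3 : σ ≤ 2 * (σ - k * (σ / (2 * k + 2))) := by
      have : 2 * (k * (σ / (2 * k + 2))) ≤ σ := by nlinarith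
      omega
    rw [div_le_iff₀ (by norm_num), mul_comm]
    exact_mod_cast h3
  have h4 : (L : ℝ) ≤ (1 - η) * (ℓ * Real.logb 2 σ) :=
    Nat.floor_le (mul_nonneg (by linarith) (by positivity))
  have h5 : (2 * b + 1 : ℝ) ≤ ℓ := by exact_mod_cast hb
  have h6 : (2 : ℝ) ^ (b + (b + (L + 1))) ≤ ((σ : ℝ) / 2) ^ ℓ := by
    rw [← Real.logb_le_logb (b := 2) (by norm_num) (by positivity) (by positivity),
      Real.logb_pow, Real.logb_pow, Real.logb_div hσ0.ne' (by norm_num),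
      Real.logb_self_eq_one (by norm_num)]
    push_cast
    have : (ℓ : ℝ) * 2 ≤ ℓ * (η * Real.logb 2 σ) := by gcongr
    linarith
  have h7 := h6.trans (pow_le_pow_left₀ (by positivity) h1 ℓ)
  rw [← pow_add, ← pow_add]
  exact_mod_cast h7

end Parameters
end OnePass

/-! ### Assembly of the lower bound -/

theorem mainTheorem3 (lam : ℝ) (hlam : 1 ≤ lam) (k : ℕ) (ε : ℝ) (hε : 0 < ε)
    (g : ℕ → ℝ) (f : ℕ → ℕ → ℝ) (hf : OnePass.IsLittleOLengthLog f)
    (b : ℕ → ℕ)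
    (hb : (fun σ : ℕ => (b σ : ℝ)) =O[atTop] fun σ : ℕ => (σ : ℝ) ^ ((k : ℝ) + 1 / lam - ε))
    (A : ∀ σ : ℕ, OnePass.Algorithm σ (b σ)) (hA : ∀ σ : ℕ, (A σ).Lossless) :
    ∀ᶠ σ : ℕ in atTop, ∃ᶠ n : ℕ in atTop, ∃ (s : List (Fin σ)) (w : List Bool),
      s.length = n ∧ (A σ).Stores s w ∧
        lam * OnePass.entropy k s * (n : ℝ) + f n σ + g σ < (w.length : ℝ) := by
  have hlam0 : 0 < lam := by linarith
  -- Budget in units of `n * log σ`: the entropy term is at most `lam * (α + θ / 2) = 1 - 10 * η`,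
  -- the output at least `1 - 2 * η` and `f` at most `η`, each up to terms constant in `n`; a margin
  -- of `7 * η` remains. The bound `1 / 40` keeps `α` positive, and the last one gives `2 * θ ≤ ε`.
  obtain ⟨η, hη0, hη1, hηε⟩ : ∃ η : ℝ, 0 < η ∧ η ≤ 1 / 40 ∧ 40 * η / lam ≤ ε := by
    refine ⟨min (1 / 40) (lam * ε / 40), by positivity, min_le_left _ _, ?_⟩
    rw [div_le_iff₀ hlam0]
    have := min_le_right (1 / 40) (lam * ε / 40)
    linarith
  set θ : ℝ := 20 * η / lam with hθ
  have hθ0 : 0 < θ := by positivity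
  set α : ℝ := 1 / lam - θ with hα
  have hα0 : 0 < α := by
    rw [hα, hθ, ← sub_div]
    exact div_pos (by linarith) hlam0
  have hb' : (fun σ : ℕ => (b σ : ℝ)) =O[atTop] fun σ : ℕ => (σ : ℝ) ^ ((k : ℝ) + α - θ) := by
    refine hb.trans (IsBigO.of_bound 1 ?_)
    filter_upwards [eventually_ge_atTop 1] with σ hσ
    have hσ' : (1 : ℝ) ≤ σ := by exact_mod_cast hσ
    rw [Real.norm_of_nonneg (by positivity), Real.norm_of_nonneg (by positivity), one_mul]
    apply Real.rpow_le_rpow_of_exponent_le hσ'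
    have : 2 * θ ≤ ε := by
      rw [hθ]
      refine le_trans (le_of_eq ?_) hηε
      ring
    rw [hα]
    linarith
  filter_upwards [OnePass.eventually_two_mul_add_le k α θ hα0 hθ0 b hb',
    OnePass.eventually_logb_le k α (θ / 2) hα0 (by positivity),
    (OnePass.tendsto_logb_natCast.const_mul_atTop hη0).eventually_ge_atTop 2,
    eventually_ge_atTop (2 * k + 2), hf η hη0] with σ h1 h2 h3 h4 h5
  set T := ⌊(σ : ℝ) ^ α⌋₊ with hT
  set q := σ / (2 * k + 2) with hq
  have hpos : 0 < T * q ^ k := by omega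
  have hT0 : 0 < T := Nat.pos_of_mul_pos_right hpos
  have hq0 : 0 < q := Nat.div_pos h4 (by omega)
  obtain ⟨ℓ, hℓ⟩ : ∃ ℓ, T * q ^ k = ℓ + 1 := ⟨T * q ^ k - 1, by omega⟩
  set L := ⌊(1 - η) * (ℓ * Real.logb 2 σ)⌋₊ with hL
  obtain ⟨N, hN⟩ := (hA σ).exists_incompressible k T q ℓ L hT0 hq0 (by omega) (by omega) hℓ.ge
    (OnePass.two_pow_le_sub_pow σ (b σ) k ℓ η (by linarith) h4 (by omega) h3)
  -- `N` does not depend on `K`, so `j` can be fixed before `K`: it forces `S ≤ η * K`, and the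
  -- terms in `j` are outgrown as `K` increases.
  obtain ⟨j, hj⟩ := exists_nat_ge (N / η)
  rw [div_le_iff₀ hη0] at hj
  have hlog : 0 < Real.logb 2 (σ : ℝ) := by
    by_contra h
    nlinarith
  have hℓ0 : (0 : ℝ) < ℓ := by exact_mod_cast (by omega : 0 < ℓ)
  set y : ℝ := ℓ * Real.logb 2 σ with hy
  have hy0 : 0 < y := by positivity
  obtain ⟨n₀, hn₀⟩ := eventually_atTop.1 h5
  rw [frequently_atTop]
  intro n₁
  obtain ⟨K, hK1, hK2, hK3⟩ : ∃ K : ℕ, n₀ + n₁ + j ≤ K ∧ (j : ℝ) ≤ (1 - η) * K ∧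
      (2 * lam + 1) * (j * y) + g σ < 7 * η * y * K := by
    have e1 : ∀ᶠ K : ℕ in atTop, (j : ℝ) ≤ (1 - η) * K :=
      (tendsto_natCast_atTop_atTop.const_mul_atTop (by linarith)).eventually_ge_atTop _
    have e2 : ∀ᶠ K : ℕ in atTop, (2 * lam + 1) * (j * y) + g σ < 7 * η * y * K :=
      (tendsto_natCast_atTop_atTop.const_mul_atTop (by positivity)).eventually_gt_atTop _
    exact ((eventually_ge_atTop (n₀ + n₁ + j)).and (e1.and e2)).exists
  obtain ⟨s, w, S, hs, hw, hent, hS, hlen⟩ := hN K j (by omega)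
  have hKℓ : K ≤ K * ℓ := Nat.le_mul_of_pos_right K (by omega)
  refine ⟨K * ℓ, by omega, s, w, hs, hw, ?_⟩
  have hfn := (le_abs_self _).trans (hn₀ (K * ℓ) (by omega))
  rw [hs] at hent
  push_cast at hent hfn ⊢
  have hSle : (S : ℝ) ≤ η * K := by
    have e1 : (S : ℝ) * (j + 1) ≤ N * K := by exact_mod_cast hS
    have e2 : (N : ℝ) * K ≤ j * η * K := by gcongr
    have e3 : (S : ℝ) * (j + 1) ≤ (η * K) * (j + 1) := by
      have : 0 ≤ η * (K : ℝ) := by positivity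
      linarith
    exact le_of_mul_le_mul_right e3 (by positivity)
  have hLy : (1 - η) * y ≤ (L : ℝ) + 1 := (Nat.lt_floor_add_one _).le
  have hlen' : (K : ℝ) * (L + 1) ≤ w.length + (j + S) * (L + 1) := by exact_mod_cast hlen
  have hL0 : (0 : ℝ) < (L : ℝ) + 1 := by positivity
  have hout : ((1 - η) * K - j) * ((1 - η) * y) ≤ w.length := by
    have e1 : ((1 - η) * K - j) * ((1 - η) * y) ≤ ((1 - η) * K - j) * ((L : ℝ) + 1) :=
      mul_le_mul_of_nonneg_left hLy (by linarith)
    have e2 : (S : ℝ) * (L + 1) ≤ η * K * (L + 1) := by gcongr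
    linarith
  have hent' : lam * (OnePass.entropy k s * (K * ℓ)) ≤
      (1 - 10 * η) * (K * y) + 2 * lam * (j * y) := by
    have e1 : lam * (OnePass.entropy k s * (K * ℓ)) ≤
        lam * (K * ℓ * ((α + θ / 2) * Real.logb 2 σ) + 2 * ℓ * j * Real.logb 2 σ) := by
      refine mul_le_mul_of_nonneg_left (hent.trans ?_) hlam0.le
      push_cast at h2
      gcongr
    refine e1.trans (le_of_eq ?_)
    have e2 : lam * (α + θ / 2) = 1 - 10 * η := by
      rw [hα, hθ]
      field_simp
      ring
    rw [← e2, hy]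
    ring
  have hjy : 0 ≤ (j : ℝ) * y := by positivity
  have hKy : 0 ≤ (K : ℝ) * y := by positivity
  have e1 : 0 ≤ η * (j * y) := by positivity
  have e2 : 0 ≤ η * η * (K * y) := by positivity
  have e3 : ((1 - η) * K - j) * ((1 - η) * y) =
      (1 - 2 * η) * (K * y) + η * η * (K * y) - j * y + η * (j * y) := by ring
  have e4 : lam * OnePass.entropy k s * (K * ℓ) = lam * (OnePass.entropy k s * (K * ℓ)) := by ring
  have e5 : η * (K * ℓ * Real.logb 2 σ) = η * (K * y) := by rw [hy]; ring
  rw [e4]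
  rw [e5] at hfn
  rw [e3] at hout
  linarith
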